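/- Let $\alpha$ be a primitive element of $GF(q)$, $n=q-1$, $0\le k\le n$. Let $(e_1,\dots,e_n)\in GF(q)^n$ be an error pattern with error locations $I=\{i\in\{1,\dots,n\}: e_i\ne 0\}$, error locator $\Lambda=\prod_{i\in I}(1-\alpha^i x)$, Fourier transform $E=\sum_{j=0}^{n-1}E_jx^j$, where $E_j=\sum_{i=1}^n e_i\alpha^{ij}$, and error evaluator $\Omega$ defined by $\Lambda E=\Omega(1-x^n)$. Let $S=\sum_{j=0}^{n-k-1}E_jx^j$ be the syndrome polynomial. Run $n-k$ iterations of the Berlekamp algorithm on $S$: start from $\lambda=1$, $\delta=1$, $\omega=0$, $\kappa=-x^{-1}$ (so $\kappa=x^{-1}$ in characteristic $2$) and register lengths $L_\lambda=0$, $L_{x\delta}=1$. In iteration $r=0,1,\dots,n-k-1$ let $\Delta$ be the coefficient of $x^r$ in $\lambda S$. If $\Delta\neq0$ and $L_\lambda<L_{x\delta}$ (equivalently $2L_\lambda\le r$), replace simultaneously $(\lambda,\delta)\leftarrow(\lambda-\Delta x\delta,\ \Delta^{-1}\lambda)$, $(\omega,\kappa)\leftarrow(\omega-\Delta x\kappa,\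 \Delta^{-1}\omega)$, $(L_\lambda,L_{x\delta})\leftarrow(L_{x\delta},L_\lambda+1)$; otherwise $(\lambda,\delta)\leftarrow(\lambda-\Delta x\delta,\ x\delta)$, $(\omega,\kappa)\leftarrow(\omega-\Delta x\kappa,\ x\kappa)$, $(L_\lambda,L_{x\delta})\leftarrow(L_\lambda,L_{x\delta}+1)$. For the resulting output put $(a,b,c,d)=(\lambda,x\delta,\omega,x\kappa)$ if $L_\lambda\le L_{x\delta}$, and $(a,b,c,d)=(x\delta,\lambda,x\kappa,\omega)$ otherwise, with $L_a,L_b$ the corresponding lengths. Call a pair of polynomials $(u,v)$ admissible if $\Lambda=au+bv$, $\deg u\le\deg\Lambda-L_a$ and $\deg v\le\deg\Lambda-L_b$ (a negative bound means that the polynomial is $0$). Then: (i) If $\deg\Lambda\le n-k$, every admissible pair $(u,v)$ satisfies $\Omega=cu+dv$. (ii) For every error pattern, of any weight, there is an admissible pair of coprime polynomials $(u,v)$ with $\Omega=cu+dv$. -/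

import Mathlib

open Polynomial

namespace ReedSolomon

noncomputable section

variable {F : Type*} [Field F]

/-- The set `I ⊆ {1, …, n}` of error locations of the error pattern `(e 1, …, e n)`;
values of `e` outside `{1, …, n}` are never used. -/
def errorLocations (n : ℕ) (e : ℕ → F) : Finset ℕ :=
  open Classical in (Finset.Icc 1 n).filter (fun i => e i ≠ 0)

/-- The error locator polynomial `Λ = ∏_{i ∈ I} (1 - α^i x)`. -/
def errorLocator (α : F) (n : ℕ) (e : ℕ → F) : F[X] :=
  ∏ i ∈ errorLocations n e, (1 - C (α ^ i) * X)

/-- The `j`-th Fourier coefficient `E_j = ∑_{i=1}^n e_i α^{ij}` of the error pattern. -/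
def fourierCoeff (α : F) (n : ℕ) (e : ℕ → F) (j : ℕ) : F :=
  ∑ i ∈ Finset.Icc 1 n, e i * α ^ (i * j)

/-- The Fourier transform `E = ∑_{j<n} E_j x^j` of the error pattern. -/
def errorTransform (α : F) (n : ℕ) (e : ℕ → F) : F[X] :=
  ∑ j ∈ Finset.range n, C (fourierCoeff α n e j) * X ^ j

/-- The syndrome polynomial `S = ∑_{j<n-k} S_j x^j`, with `S_j = E_j`: the first `n - k`
terms of the Fourier transform. -/
def syndromePoly (α : F) (n k : ℕ) (e : ℕ → F) : F[X] :=
  ∑ j ∈ Finset.range (n - k), C (fourierCoeff α n e j) * X ^ j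

/-- The error evaluator polynomial `Ω`, the exact quotient in `Λ E = Ω (1 - x^n)`;
see `errorLocator_mul_errorTransform`. -/
def errorEvaluator (α : F) (n : ℕ) (e : ℕ → F) : F[X] :=
  (errorLocator α n e * errorTransform α n e) / (1 - X ^ n)

/-- The defining identity `Λ E = Ω (1 - x^n)` of the error evaluator, whenever `α^n = 1`. -/
theorem errorLocator_mul_errorTransform (α : F) (n : ℕ) (hn : 0 < n) (hα : α ^ n = 1)
    (e : ℕ → F) :
    errorLocator α n e * errorTransform α n e = errorEvaluator α n e * (1 - X ^ n) := by
  have hE : errorTransform α n e = ∑ i ∈ errorLocations n e,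
      C (e i) * ∑ j ∈ Finset.range n, (C (α ^ i) * X) ^ j := by
    have h1 : errorTransform α n e = ∑ i ∈ Finset.Icc 1 n,
        C (e i) * ∑ j ∈ Finset.range n, (C (α ^ i) * X) ^ j := by
      simp only [errorTransform, fourierCoeff, map_sum, Finset.sum_mul, Finset.mul_sum]
      rw [Finset.sum_comm]
      refine Finset.sum_congr rfl fun i _ => Finset.sum_congr rfl fun j _ => ?_
      rw [mul_pow, C_mul, pow_mul, C_pow, mul_assoc]
    rw [h1, errorLocations, Finset.sum_filter]
    refine Finset.sum_congr rfl fun i _ => ?_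
    by_cases h : e i = 0 <;> simp [h]
  have hdvd : (1 - X ^ n : F[X]) ∣ errorLocator α n e * errorTransform α n e := by
    rw [hE, Finset.mul_sum]
    refine Finset.dvd_sum fun i hi => ?_
    have h2 : (1 - C (α ^ i) * X) * ∑ j ∈ Finset.range n, (C (α ^ i) * X) ^ j
        = (1 - X ^ n : F[X]) := by
      rw [mul_neg_geom_sum, mul_pow, ← C_pow, ← pow_mul, mul_comm i n, pow_mul, hα]
      simp
    refine ⟨(∏ j ∈ (errorLocations n e).erase i, (1 - C (α ^ j) * X)) * C (e i), ?_⟩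
    rw [errorLocator, ← Finset.mul_prod_erase _ _ hi, ← h2]
    ring
  have hne : (1 - X ^ n : F[X]) ≠ 0 := by
    intro h
    have h3 := congrArg (fun p : F[X] => p.coeff n) h
    simp [coeff_one, hn.ne'] at h3
  rw [errorEvaluator, mul_comm _ (1 - X ^ n : F[X])]
  exact (EuclideanDomain.mul_div_cancel' hne hdvd).symm

/-- The state of the Berlekamp algorithm.  The correction polynomials `δ` and `κ` are stored
as `x δ` and `x κ`, which are polynomials even though `κ` starts as a multiple of `x⁻¹`. -/
structure BerlekampState (F : Type*) [Field F] where
  /-- the connection polynomial `λ` -/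
  lam : F[X]
  /-- `x δ`, where `δ` is the correction polynomial -/
  xdel : F[X]
  /-- the auxiliary polynomial `ω`, updated along with `λ` -/
  om : F[X]
  /-- `x κ`, where `κ` is the auxiliary polynomial that is updated along with `δ` -/
  xkap : F[X]
  /-- the shift register length `L_λ` -/
  lenLam : ℕ
  /-- the shift register length `L_{xδ}` -/
  lenXdel : ℕ

/-- The initial state `λ = 1`, `δ = 1`, `ω = 0`, `κ = -x⁻¹` (in characteristic two,
`κ = x⁻¹`). -/
def berlekampInit (F : Type*) [Field F] : BerlekampState F where
  lam := 1
  xdel := X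
  om := 0
  xkap := -1
  lenLam := 0
  lenXdel := 1

/-- Iteration number `r` (counted from `0`) on the syndrome polynomial `S`.  The discrepancy
is `Δ = ∑_j λ_j S_{r-j}`.  Then `(λ, ω) ← (λ - Δ x δ, ω - Δ x κ)`, and
`(δ, κ) ← Δ⁻¹ (λ, ω)` if `Δ ≠ 0` and the register has to become longer, while
`(δ, κ) ← x (δ, κ)` otherwise.  Before this iteration `L_λ + L_{xδ} = r + 1`, so the test
`L_λ < L_{xδ}` is the usual `2 L_λ ≤ r`, and the new length `L_{xδ}` of `λ` is the usual
`r + 1 - L_λ`. -/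
def berlekampStep (S : F[X]) (r : ℕ) (s : BerlekampState F) : BerlekampState F :=
  let Δ : F := (s.lam * S).coeff r
  open Classical in
  if Δ ≠ 0 ∧ s.lenLam < s.lenXdel then
    { lam := s.lam - C Δ * s.xdel
      xdel := X * (C Δ⁻¹ * s.lam)
      om := s.om - C Δ * s.xkap
      xkap := X * (C Δ⁻¹ * s.om)
      lenLam := s.lenXdel
      lenXdel := s.lenLam + 1 }
  else
    { lam := s.lam - C Δ * s.xdel
      xdel := X * s.xdel
      om := s.om - C Δ * s.xkap
      xkap := X * s.xkap
      lenLam := s.lenLam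
      lenXdel := s.lenXdel + 1 }

/-- The state of the Berlekamp algorithm on `S` after `N` iterations. -/
def berlekamp (S : F[X]) : ℕ → BerlekampState F
  | 0 => berlekampInit F
  | N + 1 => berlekampStep S N (berlekamp S N)

namespace BerlekampState

/-- `a = λ` if `L_λ ≤ L_{xδ}`, and `a = x δ` otherwise. -/
def a (s : BerlekampState F) : F[X] := if s.lenLam ≤ s.lenXdel then s.lam else s.xdel

/-- `b = x δ` if `L_λ ≤ L_{xδ}`, and `b = λ` otherwise. -/
def b (s : BerlekampState F) : F[X] := if s.lenLam ≤ s.lenXdel then s.xdel else s.lam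

/-- `c = ω` if `a = λ`, `b = x δ`, and `c = x κ` otherwise. -/
def c (s : BerlekampState F) : F[X] := if s.lenLam ≤ s.lenXdel then s.om else s.xkap

/-- `d = x κ` if `a = λ`, `b = x δ`, and `d = ω` otherwise. -/
def d (s : BerlekampState F) : F[X] := if s.lenLam ≤ s.lenXdel then s.xkap else s.om

/-- The shift register length `L_a` of `a`. -/
def lenA (s : BerlekampState F) : ℕ := if s.lenLam ≤ s.lenXdel then s.lenLam else s.lenXdel

/-- The shift register length `L_b` of `b`. -/
def lenB (s : BerlekampState F) : ℕ := if s.lenLam ≤ s.lenXdel then s.lenXdel else s.lenLam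

end BerlekampState

/-- `Λ = a u + b v` with `deg u ≤ deg Λ - L_a` and `deg v ≤ deg Λ - L_b` (so `u = 0`, resp.
`v = 0`, when the bound is negative). -/
structure IsLocatorDecomposition (s : BerlekampState F) (Λ u v : F[X]) : Prop where
  eq : Λ = s.a * u + s.b * v
  degree_u : u.degree + (s.lenA : WithBot ℕ) ≤ Λ.degree
  degree_v : v.degree + (s.lenB : WithBot ℕ) ≤ Λ.degree

end

end ReedSolomon

/-! Put `N = n - k`. The matrix with rows `(lam, xdel)` and `(om, xkap)` has determinant `-X ^ N`,
and each column `(p, q)` satisfies `p * S ≡ q` modulo `X ^ N`, as does `(Λ, Ω)`. Cramer's rule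
expresses `(Λ, Ω)` through the columns. The numerators are divisible by `X ^ N` by these
congruences, so `u` and `v` are polynomials, and the two lengths summing to `N + 1` bounds their
degrees (`exists_decomposition`). A Bézout relation for `Λ`, `Ω` becomes one for `u`, `v`.

For (i), `Ω - (c * u + d * v)` is divisible by `X ^ N` but has degree below `deg Λ ≤ N`, so it
vanishes (`evaluator_eq`). -/

namespace ReedSolomon

/-! ### Invariants of the algorithm and decomposition of solutions of the key equation -/

section Berlekamp

variable {F : Type*} [Field F]

/-- The invariants of the Berlekamp algorithm on `S` before iteration number `r`. -/
structure BerlekampInvariant (S : F[X]) (r : ℕ) (s : BerlekampState F) : Prop where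
  len_add : s.lenLam + s.lenXdel = r + 1
  lenXdel_pos : 0 < s.lenXdel
  degree_lam : s.lam.degree ≤ (s.lenLam : WithBot ℕ)
  degree_xdel : s.xdel.degree ≤ (s.lenXdel : WithBot ℕ)
  degree_om : s.om.degree < (s.lenLam : WithBot ℕ)
  degree_xkap : s.xkap.degree < (s.lenXdel : WithBot ℕ)
  dvd_lam : X ^ r ∣ s.lam * S - s.om
  dvd_xdel : X ^ (r + 1) ∣ s.xdel * S - s.xkap - X ^ r
  det : s.lam * s.xkap - s.om * s.xdel = -X ^ r

/-- The choice `xkap = -1` makes the residual `xdel * S - xkap` congruent to `1` modulo `X` and the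
determinant `-1`. -/
theorem berlekampInvariant_init (S : F[X]) : BerlekampInvariant S 0 (berlekampInit F) where
  len_add := rfl
  lenXdel_pos := Nat.one_pos
  degree_lam := by simp [berlekampInit]
  degree_xdel := by simp [berlekampInit]
  degree_om := by simp [berlekampInit]
  degree_xkap := by simp [berlekampInit]
  dvd_lam := by simp
  dvd_xdel := by simp [berlekampInit]
  det := by simp [berlekampInit]

theorem degree_X_mul_le {p : F[X]} {m : ℕ} (h : p.degree ≤ (m : WithBot ℕ)) :
    (X * p).degree ≤ ((m + 1 : ℕ) : WithBot ℕ) := by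
  rw [degree_le_iff_coeff_zero] at h ⊢
  intro j hj
  have hj : m + 1 < j := by exact_mod_cast hj
  obtain ⟨i, rfl⟩ : ∃ i, j = i + 1 := ⟨j - 1, by omega⟩
  rw [coeff_X_mul]
  exact h i (by exact_mod_cast (by omega : m < i))

theorem degree_X_mul_lt {p : F[X]} {m : ℕ} (h : p.degree < (m : WithBot ℕ)) :
    (X * p).degree < ((m + 1 : ℕ) : WithBot ℕ) := by
  rw [degree_lt_iff_coeff_zero] at h ⊢
  intro j hj
  obtain ⟨i, rfl⟩ : ∃ i, j = i + 1 := ⟨j - 1, by omega⟩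
  rw [coeff_X_mul]
  exact h i (by omega)

theorem X_pow_succ_dvd_sub_coeff {p : F[X]} {r : ℕ} (h : X ^ r ∣ p) :
    X ^ (r + 1) ∣ p - C (p.coeff r) * X ^ r := by
  obtain ⟨q, rfl⟩ := h
  have h1 : (X ^ r * q).coeff r = q.coeff 0 := by
    simpa using coeff_X_pow_mul q r 0
  rw [h1, mul_comm (C _), ← mul_sub, pow_succ]
  exact mul_dvd_mul_left _ (X_dvd_iff.mpr (by simp))

theorem BerlekampInvariant.X_pow_succ_dvd_discrepancy {S : F[X]} {r : ℕ} {s : BerlekampState F}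
    (h : BerlekampInvariant S r s) :
    X ^ (r + 1) ∣ s.lam * S - s.om - C ((s.lam * S).coeff r) * X ^ r := by
  have h1 := X_pow_succ_dvd_sub_coeff h.dvd_lam
  -- Positivity of `lenXdel` gives `lenLam ≤ r`, so `om` does not contribute to the discrepancy.
  have h2 : s.om.coeff r = 0 := by
    refine coeff_eq_zero_of_degree_lt (h.degree_om.trans_le ?_)
    have := h.len_add
    have := h.lenXdel_pos
    exact_mod_cast (by omega : s.lenLam ≤ r)
  rwa [coeff_sub, h2, sub_zero] at h1

theorem degree_C_mul_le_degree (t : F) (p : F[X]) : (C t * p).degree ≤ p.degree := by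
  rw [← smul_eq_C_mul]
  exact degree_smul_le t p

/-- The residual of `xdel` is normalized to `X ^ r`, so subtracting `t` times that column cancels
the discrepancy. Either branch multiplies the determinant by `X`; when the columns are exchanged,
the sign is absorbed by the factor `-t`. -/
theorem BerlekampInvariant.step {S : F[X]} {r : ℕ} {s : BerlekampState F}
    (h : BerlekampInvariant S r s) :
    BerlekampInvariant S (r + 1) (berlekampStep S r s) := by
  have hd := h.X_pow_succ_dvd_discrepancy
  set t : F := (s.lam * S).coeff r with ht
  have hlen := h.len_add
  have hlam : X ^ (r + 1) ∣ (s.lam - C t * s.xdel) * S - (s.om - C t * s.xkap) := by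
    have := dvd_sub hd (h.dvd_xdel.mul_left (C t))
    convert this using 1
    ring
  -- `m` is the new length of `lam`: `lenXdel` when the register grows, `lenLam` otherwise.
  have hdeg1 : ∀ m : ℕ, s.lenLam ≤ m → (t ≠ 0 → s.lenXdel ≤ m) →
      (s.lam - C t * s.xdel).degree ≤ (m : WithBot ℕ) := by
    intro m h1 h2
    refine (degree_sub_le _ _).trans (max_le (h.degree_lam.trans (by exact_mod_cast h1)) ?_)
    by_cases h0 : t = 0
    · simp [h0]
    · exact (degree_C_mul_le_degree t _).trans (h.degree_xdel.trans (by exact_mod_cast h2 h0))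
  have hdeg2 : ∀ m : ℕ, s.lenLam ≤ m → (t ≠ 0 → s.lenXdel ≤ m) →
      (s.om - C t * s.xkap).degree < (m : WithBot ℕ) := by
    intro m h1 h2
    refine (degree_sub_le _ _).trans_lt
      (max_lt (h.degree_om.trans_le (by exact_mod_cast h1)) ?_)
    by_cases h0 : t = 0
    · simp [h0]
    · exact (degree_C_mul_le_degree t _).trans_lt (h.degree_xkap.trans_le (by exact_mod_cast h2 h0))
  unfold berlekampStep
  simp only [← ht]
  split_ifs with hc
  · obtain ⟨h0, hlt⟩ := hc
    have hC : C t⁻¹ * C t = (1 : F[X]) := by rw [← C_mul, inv_mul_cancel₀ h0, C_1]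
    refine ⟨by simp only; omega, Nat.succ_pos _, hdeg1 _ hlt.le fun _ => le_rfl,
      degree_X_mul_le ((degree_C_mul_le_degree _ _).trans h.degree_lam), hdeg2 _ hlt.le fun _ => le_rfl,
      degree_X_mul_lt ((degree_C_mul_le_degree _ _).trans_lt h.degree_om), hlam, ?_, ?_⟩
    · have := mul_dvd_mul_left X (hd.mul_left (C t⁻¹))
      rw [← pow_succ'] at this
      convert this using 1
      simp only
      linear_combination (X ^ (r + 1)) * hC
    · simp only
      linear_combination (X * s.xkap * s.lam - X * s.om * s.xdel) * hC + X * h.det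
  · have hle : t ≠ 0 → s.lenXdel ≤ s.lenLam := fun h0 => not_lt.mp fun hlt => hc ⟨h0, hlt⟩
    refine ⟨by simp only; omega, Nat.succ_pos _, hdeg1 _ le_rfl hle,
      degree_X_mul_le h.degree_xdel, hdeg2 _ le_rfl hle, degree_X_mul_lt h.degree_xkap, hlam,
      ?_, ?_⟩
    · have := mul_dvd_mul_left X h.dvd_xdel
      rw [← pow_succ'] at this
      convert this using 1
      simp only
      ring
    · simp only
      linear_combination X * h.det

theorem berlekampInvariant (S : F[X]) (r : ℕ) : BerlekampInvariant S r (berlekamp S r) := by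
  induction r with
  | zero => exact berlekampInvariant_init S
  | succ r ih => exact ih.step

theorem BerlekampInvariant.X_pow_dvd_xdel {S : F[X]} {r : ℕ} {s : BerlekampState F}
    (h : BerlekampInvariant S r s) : X ^ r ∣ s.xdel * S - s.xkap := by
  have := ((pow_dvd_pow X r.le_succ).trans h.dvd_xdel).add (dvd_refl (X ^ r))
  simpa using this

theorem degree_add_le_of_X_pow_mul {p q : F[X]} {N l m d : ℕ} (hlm : l + m = N + 1)
    (hp : X ^ N * q = p) (h : p.degree < ((m + d : ℕ) : WithBot ℕ)) :
    q.degree + (l : WithBot ℕ) ≤ (d : WithBot ℕ) := by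
  by_cases hq : q = 0
  · simp [hq]
  rw [← hp, degree_mul, degree_X_pow, degree_eq_natDegree hq] at h
  rw [degree_eq_natDegree hq]
  have h : N + q.natDegree < m + d := by exact_mod_cast h
  exact_mod_cast (by omega : q.natDegree + l ≤ d)

theorem degree_mul_lt_add {p q : F[X]} {l m : ℕ} (hp : p.degree < (l : WithBot ℕ))
    (hq : q.degree ≤ (m : WithBot ℕ)) : (p * q).degree < ((l + m : ℕ) : WithBot ℕ) := by
  by_cases hq0 : q = 0
  · simp [hq0]
  by_cases hp0 : p = 0
  · simp [hp0]
  rw [degree_mul, degree_eq_natDegree hp0, degree_eq_natDegree hq0]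
  rw [degree_eq_natDegree hp0] at hp
  rw [degree_eq_natDegree hq0] at hq
  have hp : p.natDegree < l := by exact_mod_cast hp
  have hq : q.natDegree ≤ m := by exact_mod_cast hq
  exact_mod_cast (by omega : p.natDegree + q.natDegree < l + m)

theorem BerlekampInvariant.exists_decomposition {S : F[X]} {N : ℕ} {s : BerlekampState F}
    (h : BerlekampInvariant S N s) {Λ Ω : F[X]} (hdeg : Ω.degree < Λ.degree)
    (hkey : X ^ N ∣ Λ * S - Ω) :
    ∃ u v : F[X], Λ = s.lam * u + s.xdel * v ∧ Ω = s.om * u + s.xkap * v ∧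
      u.degree + (s.lenLam : WithBot ℕ) ≤ Λ.degree ∧
      v.degree + (s.lenXdel : WithBot ℕ) ≤ Λ.degree := by
  have hΛ : Λ ≠ 0 := by
    rintro rfl
    simp at hdeg
  have hN : (X ^ N : F[X]) ≠ 0 := pow_ne_zero _ X_ne_zero
  have hlen := h.len_add
  have hd := degree_eq_natDegree hΛ
  have hΛd := hd.le
  rw [hd] at hdeg ⊢
  -- The Cramer numerators, with the sign of the determinant `-X ^ N` absorbed.
  obtain ⟨u, hu⟩ : X ^ N ∣ s.xdel * Ω - s.xkap * Λ := by
    have := (h.X_pow_dvd_xdel.mul_left Λ).sub (hkey.mul_left s.xdel)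
    convert this using 1
    ring
  obtain ⟨v, hv⟩ : X ^ N ∣ s.om * Λ - s.lam * Ω := by
    have := (hkey.mul_left s.lam).sub (h.dvd_lam.mul_left Λ)
    convert this using 1
    ring
  refine ⟨u, v, mul_left_cancel₀ hN ?_, mul_left_cancel₀ hN ?_, ?_, ?_⟩
  · linear_combination Λ * h.det + s.lam * hu + s.xdel * hv
  · linear_combination Ω * h.det + s.om * hu + s.xkap * hv
  · refine degree_add_le_of_X_pow_mul hlen hu.symm
      ((degree_sub_le _ _).trans_lt (max_lt ?_ (degree_mul_lt_add h.degree_xkap hΛd)))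
    rw [mul_comm, add_comm]
    exact degree_mul_lt_add hdeg h.degree_xdel
  · refine degree_add_le_of_X_pow_mul ((add_comm _ _).trans hlen) hv.symm
      ((degree_sub_le _ _).trans_lt (max_lt (degree_mul_lt_add h.degree_om hΛd) ?_))
    rw [mul_comm, add_comm]
    exact degree_mul_lt_add hdeg h.degree_lam

theorem degree_mul_lt_of_degree_add_le {p q Λ : F[X]} {l : ℕ} (hΛ : Λ ≠ 0)
    (hp : p.degree < (l : WithBot ℕ)) (hq : q.degree + (l : WithBot ℕ) ≤ Λ.degree) :
    (p * q).degree < Λ.degree := by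
  by_cases hq0 : q = 0
  · simpa [hq0, bot_lt_iff_ne_bot] using hΛ
  refine lt_of_lt_of_le ?_ hq
  rw [degree_mul, add_comm]
  exact WithBot.add_lt_add_left (degree_ne_bot.mpr hq0) hp

theorem BerlekampInvariant.evaluator_eq {S : F[X]} {N : ℕ} {s : BerlekampState F}
    (h : BerlekampInvariant S N s) {Λ Ω : F[X]} (hdeg : Ω.degree < Λ.degree)
    (hkey : X ^ N ∣ Λ * S - Ω) (hN : Λ.natDegree ≤ N) {u v : F[X]}
    (heq : Λ = s.lam * u + s.xdel * v)
    (hu : u.degree + (s.lenLam : WithBot ℕ) ≤ Λ.degree)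
    (hv : v.degree + (s.lenXdel : WithBot ℕ) ≤ Λ.degree) :
    Ω = s.om * u + s.xkap * v := by
  have hΛ : Λ ≠ 0 := by
    rintro rfl
    simp at hdeg
  have hdvd : X ^ N ∣ Ω - (s.om * u + s.xkap * v) := by
    have := ((h.dvd_lam.mul_left u).add (h.X_pow_dvd_xdel.mul_left v)).sub hkey
    convert this using 1
    linear_combination S * heq
  refine sub_eq_zero.mp (eq_zero_of_dvd_of_degree_lt hdvd ?_)
  have hb : (Ω - (s.om * u + s.xkap * v)).degree < Λ.degree :=
    (degree_sub_le _ _).trans_lt (max_lt hdeg ((degree_add_le _ _).trans_lt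
      (max_lt (degree_mul_lt_of_degree_add_le hΛ h.degree_om hu)
        (degree_mul_lt_of_degree_add_le hΛ h.degree_xkap hv))))
  rw [degree_X_pow]
  exact hb.trans_le (natDegree_le_iff_degree_le.mp hN)

end Berlekamp

/-! ### Degree, coprimality and key equation for the locator and evaluator -/

section ErrorPattern

variable {F : Type*} [Field F] {α : F} {n : ℕ}

theorem mem_errorLocations {e : ℕ → F} {i : ℕ} :
    i ∈ errorLocations n e ↔ (1 ≤ i ∧ i ≤ n) ∧ e i ≠ 0 := by
  classical
  simp [errorLocations]

theorem errorTransform_eq_sum_errorLocations (α : F) (n : ℕ) (e : ℕ → F) :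
    errorTransform α n e = ∑ i ∈ errorLocations n e,
      C (e i) * ∑ j ∈ Finset.range n, (C (α ^ i) * X) ^ j := by
  have h1 : errorTransform α n e = ∑ i ∈ Finset.Icc 1 n,
      C (e i) * ∑ j ∈ Finset.range n, (C (α ^ i) * X) ^ j := by
    simp only [errorTransform, fourierCoeff, map_sum, Finset.sum_mul, Finset.mul_sum]
    rw [Finset.sum_comm]
    refine Finset.sum_congr rfl fun i _ => Finset.sum_congr rfl fun j _ => ?_
    rw [mul_pow, C_mul, pow_mul, C_pow, mul_assoc]
  rw [h1, errorLocations, Finset.sum_filter]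
  refine Finset.sum_congr rfl fun i _ => ?_
  by_cases h : e i = 0 <;> simp [h]

theorem one_sub_X_pow_ne_zero (hn : 0 < n) : (1 - X ^ n : F[X]) ≠ 0 := by
  intro h
  have h3 := congrArg (fun p : F[X] => p.coeff n) h
  simp [coeff_one, hn.ne'] at h3

/-- Since `α ^ n = 1`, each geometric sum is `(1 - X ^ n) / (1 - α ^ i X)`. The degree bound and
coprimality are read off from this form. -/
theorem errorEvaluator_eq_sum (hn : 0 < n) (hα : α ^ n = 1) (e : ℕ → F) :
    errorEvaluator α n e = ∑ i ∈ errorLocations n e,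
      C (e i) * ∏ j ∈ (errorLocations n e).erase i, (1 - C (α ^ j) * X) := by
  refine mul_right_cancel₀ (one_sub_X_pow_ne_zero hn) ?_
  rw [← errorLocator_mul_errorTransform α n hn hα, errorTransform_eq_sum_errorLocations,
    Finset.mul_sum, Finset.sum_mul]
  refine Finset.sum_congr rfl fun i hi => ?_
  have h2 : (1 - C (α ^ i) * X) * ∑ j ∈ Finset.range n, (C (α ^ i) * X) ^ j
      = (1 - X ^ n : F[X]) := by
    rw [mul_neg_geom_sum, mul_pow, ← C_pow, ← pow_mul, mul_comm i n, pow_mul, hα]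
    simp
  rw [errorLocator, ← Finset.mul_prod_erase _ _ hi, ← h2]
  ring

theorem degree_one_sub_C_mul_X {t : F} (ht : t ≠ 0) : (1 - C t * X : F[X]).degree = 1 := by
  have : (1 - C t * X : F[X]) = C (-t) * X + C 1 := by
    rw [C_neg, C_1]
    ring
  rw [this, degree_linear (neg_ne_zero.mpr ht)]

theorem errorLocator_ne_zero (hα : α ≠ 0) (e : ℕ → F) : errorLocator α n e ≠ 0 :=
  Finset.prod_ne_zero_iff.mpr fun i _ h => by
    have h1 := degree_one_sub_C_mul_X (pow_ne_zero i hα)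
    rw [h, degree_zero] at h1
    exact absurd h1 (by decide)

theorem degree_errorEvaluator_lt (hn : 0 < n) (hα : α ^ n = 1) (e : ℕ → F) :
    (errorEvaluator α n e).degree < (errorLocator α n e).degree := by
  have hα0 : α ≠ 0 := by
    rintro rfl
    simp [hn.ne'] at hα
  have hΛ := errorLocator_ne_zero (n := n) hα0 e
  rw [errorEvaluator_eq_sum hn hα]
  refine (degree_sum_le _ _).trans_lt ((Finset.sup_lt_iff ?_).mpr fun i hi => ?_)
  · exact bot_lt_iff_ne_bot.mpr (degree_ne_bot.mpr hΛ)
  refine (degree_C_mul_le_degree _ _).trans_lt ?_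
  have hprod := Finset.mul_prod_erase (errorLocations n e)
    (fun j => (1 - C (α ^ j) * X : F[X])) hi
  rw [errorLocator, ← hprod, degree_mul, degree_one_sub_C_mul_X (pow_ne_zero i hα0)]
  have hne : ∏ j ∈ (errorLocations n e).erase i, (1 - C (α ^ j) * X : F[X]) ≠ 0 := by
    intro h
    apply hΛ
    rw [errorLocator, ← hprod, h, mul_zero]
  rw [degree_eq_natDegree hne]
  exact_mod_cast (by omega : ∀ m : ℕ, m < 1 + m) _

theorem isCoprime_one_sub_C_mul_X {s t : F} (h : s ≠ t) :
    IsCoprime (1 - C s * X : F[X]) (1 - C t * X) := by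
  refine ⟨C (t - s)⁻¹ * C t, -(C (t - s)⁻¹ * C s), ?_⟩
  have h1 : C (t - s)⁻¹ * C (t - s) = (1 : F[X]) := by
    rw [← C_mul, inv_mul_cancel₀ (sub_ne_zero.mpr h.symm), C_1]
  rw [C_sub] at h1
  linear_combination h1

theorem pow_ne_pow_of_mem_errorLocations (hα : IsPrimitiveRoot α n) {e : ℕ → F} {i j : ℕ}
    (hi : i ∈ errorLocations n e) (hj : j ∈ errorLocations n e) (hij : i ≠ j) :
    α ^ i ≠ α ^ j := by
  obtain ⟨⟨hi1, hin⟩, -⟩ := mem_errorLocations.mp hi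
  obtain ⟨⟨hj1, hjn⟩, -⟩ := mem_errorLocations.mp hj
  have hα0 : α ≠ 0 := hα.ne_zero (by omega)
  intro h
  -- Locations run over `1, …, n`, while `pow_inj` needs exponents below `n`; hence the shift by
  -- one.
  obtain ⟨i, rfl⟩ : ∃ m, i = m + 1 := ⟨i - 1, by omega⟩
  obtain ⟨j, rfl⟩ : ∃ m, j = m + 1 := ⟨j - 1, by omega⟩
  rw [pow_succ, pow_succ] at h
  have := hα.pow_inj (by omega) (by omega) (mul_right_cancel₀ hα0 h)
  omega

/-- Modulo `1 - α ^ i X` only the `i`-th summand of the evaluator survives: a nonzero constant times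
factors coprime to `1 - α ^ i X`. -/
theorem isCoprime_errorLocator_errorEvaluator (hn : 0 < n) (hα : IsPrimitiveRoot α n)
    (e : ℕ → F) : IsCoprime (errorLocator α n e) (errorEvaluator α n e) := by
  refine IsCoprime.prod_left fun i hi => ?_
  rw [errorEvaluator_eq_sum hn hα.pow_eq_one, ← Finset.add_sum_erase _ _ hi]
  obtain ⟨q, hq⟩ : (1 - C (α ^ i) * X : F[X]) ∣ ∑ m ∈ (errorLocations n e).erase i,
      C (e m) * ∏ j ∈ (errorLocations n e).erase m, (1 - C (α ^ j) * X) :=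
    Finset.dvd_sum fun m hm => (Finset.dvd_prod_of_mem (fun j => (1 - C (α ^ j) * X : F[X]))
      (Finset.mem_erase.mpr ⟨(Finset.ne_of_mem_erase hm).symm, hi⟩)).mul_left _
  rw [hq]
  refine IsCoprime.add_mul_left_right ?_ q
  refine IsCoprime.mul_right ?_ (IsCoprime.prod_right fun j hj => ?_)
  · exact ⟨0, C (e i)⁻¹, by
      rw [zero_mul, zero_add, ← C_mul, inv_mul_cancel₀ (mem_errorLocations.mp hi).2, C_1]⟩
  · exact isCoprime_one_sub_C_mul_X (pow_ne_pow_of_mem_errorLocations hα hi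
      (Finset.mem_of_mem_erase hj) (Finset.ne_of_mem_erase hj).symm)

theorem X_pow_dvd_errorTransform_sub_syndromePoly (α : F) (n k : ℕ) (e : ℕ → F) :
    X ^ (n - k) ∣ errorTransform α n e - syndromePoly α n k e := by
  rw [errorTransform, syndromePoly, ← Finset.sum_range_add_sum_Ico _ (Nat.sub_le n k),
    add_sub_cancel_left]
  exact Finset.dvd_sum fun j hj => (pow_dvd_pow X (Finset.mem_Ico.mp hj).1).mul_left _

/-- With `E` the transform, `Λ * S - Ω = -(Λ * (E - S) + Ω * X ^ n)`. -/
theorem key_equation (hn : 0 < n) (hα : α ^ n = 1) (k : ℕ) (e : ℕ → F) :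
    X ^ (n - k) ∣ errorLocator α n e * syndromePoly α n k e - errorEvaluator α n e := by
  have h1 := (X_pow_dvd_errorTransform_sub_syndromePoly α n k e).mul_left (errorLocator α n e)
  have h2 := (pow_dvd_pow (X : F[X]) (Nat.sub_le n k)).mul_left (errorEvaluator α n e)
  have h3 := (h1.add h2).neg_right
  convert h3 using 1
  linear_combination errorLocator_mul_errorTransform α n hn hα e

end ErrorPattern

/-! ### Transfer of coprimality and the main theorem -/

theorem isCoprime_of_linear_combinations {R : Type*} [CommRing R] {a b c d u v : R}
    (h : IsCoprime (a * u + b * v) (c * u + d * v)) : IsCoprime u v := by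
  obtain ⟨p, q, hpq⟩ := h
  exact ⟨p * a + q * c, p * b + q * d, by linear_combination hpq⟩

end ReedSolomon

theorem lemma4 {F : Type*} [Field F] [Fintype F] (α : F) (n k : ℕ)
    (hn : n = Fintype.card F - 1) (hα : IsPrimitiveRoot α n) (hk : k ≤ n)
    (e : ℕ → F) (s : ReedSolomon.BerlekampState F)
    (hs : s = ReedSolomon.berlekamp (ReedSolomon.syndromePoly α n k e) (n - k))
    (Λ Ω : F[X]) (hΛ : Λ = ReedSolomon.errorLocator α n e)
    (hΩ : Ω = ReedSolomon.errorEvaluator α n e) :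
    (Λ.natDegree ≤ n - k → ∀ u v : F[X],
      ReedSolomon.IsLocatorDecomposition s Λ u v → Ω = s.c * u + s.d * v) ∧
    (∃ u v : F[X], IsCoprime u v ∧
      ReedSolomon.IsLocatorDecomposition s Λ u v ∧ Ω = s.c * u + s.d * v) := by
  have hn0 : 0 < n := by
    have := Fintype.one_lt_card (α := F)
    omega
  have hinv := ReedSolomon.berlekampInvariant (ReedSolomon.syndromePoly α n k e) (n - k)
  rw [← hs] at hinv
  have hdeg := ReedSolomon.degree_errorEvaluator_lt hn0 hα.pow_eq_one e
  have hkey := ReedSolomon.key_equation hn0 hα.pow_eq_one k e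
  have hcop := ReedSolomon.isCoprime_errorLocator_errorEvaluator hn0 hα e
  rw [← hΛ, ← hΩ] at hdeg hkey hcop
  constructor
  · rintro hN u v ⟨heq, hu, hv⟩
    simp only [ReedSolomon.BerlekampState.a, ReedSolomon.BerlekampState.b,
      ReedSolomon.BerlekampState.c, ReedSolomon.BerlekampState.d,
      ReedSolomon.BerlekampState.lenA, ReedSolomon.BerlekampState.lenB] at heq hu hv ⊢
    split_ifs at heq hu hv ⊢ with hl
    · exact hinv.evaluator_eq hdeg hkey hN heq hu hv
    · rw [add_comm] at heq ⊢
      exact hinv.evaluator_eq hdeg hkey hN heq hv hu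
  · obtain ⟨u, v, h1, h2, hu, hv⟩ := hinv.exists_decomposition hdeg hkey
    have huv : IsCoprime u v := by
      rw [h1, h2] at hcop
      exact ReedSolomon.isCoprime_of_linear_combinations hcop
    by_cases hl : s.lenLam ≤ s.lenXdel
    · refine ⟨u, v, huv, ⟨?_, ?_, ?_⟩, ?_⟩ <;>
        simpa only [ReedSolomon.BerlekampState.a, ReedSolomon.BerlekampState.b,
          ReedSolomon.BerlekampState.c, ReedSolomon.BerlekampState.d,
          ReedSolomon.BerlekampState.lenA, ReedSolomon.BerlekampState.lenB, if_pos hl]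
    -- Here `a = xdel` and `b = lam`, so `u` and `v` trade places.
    · rw [add_comm] at h1 h2
      refine ⟨v, u, huv.symm, ⟨?_, ?_, ?_⟩, ?_⟩ <;>
        simpa only [ReedSolomon.BerlekampState.a, ReedSolomon.BerlekampState.b,
          ReedSolomon.BerlekampState.c, ReedSolomon.BerlekampState.d,
          ReedSolomon.BerlekampState.lenA, ReedSolomon.BerlekampState.lenB, if_neg hl]
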